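/- Let $\sigma>0$ and let $V:[0,+\infty)\to[0,1)$ be continuous and strictly increasing, with $0<V(x)<1$ for $x>0$, regularly varying at $0$ with index $\sigma$, i.e. $\lim_{x\to0^+}V(tx)/V(x)=t^{\sigma}$ for every $t>0$, and such that $\liminf_{x\to 0^+}x^{\sigma}/V(x)>0$ (the value $+\infty$ is allowed). Let $T:[0,1]\to[0,1]$ be a Borel measurable map for which there is $\delta>0$ such that $T$ is injective on $[0,1]\cap[0,\delta)$ and either $T(x)=x(1+V(x))$ for all $x\in[0,1]\cap[0,\delta)$, or $T(x)=x(1-V(x))$ for all $x\in[0,1]\cap[0,\delta)$. Let $\alpha,\beta$ be real numbers such that either $\alpha=\sigma\le 1$ and $\beta=0$, or $0\le\alpha<\min\{\sigma,1\}$, $\beta\ge0$ and $\alpha+\beta>0$. Define $\omega_{\alpha,\beta}:[0,+\infty)\to[0,+\infty)$ by $\omega_{\alpha,\beta}(0)=0$, $\omega_{\alpha,\beta}(h)=h^{\alpha}(-\log h)^{-\beta}$ for $0<h<h_0$, and $\omega_{\alpha,\beta}(h)=h_0^{\alpha}(-\log h_0)^{-\beta}$ for $h\ge h_0$, where $h_0\in(0,1)$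 is small enough that $\omega_{\alpha,\beta}$ is concave. Then there is a function $f:[0,1]\to\mathbb R$ satisfying, for some constant $C>0$, $|f(x)-f(y)|\le C\,\omega_{\alpha,\beta}(|x-y|)$ for all $x,y\in[0,1]$ (that is, $f\in\mathscr C^{\omega_{\alpha,\beta}}([0,1])$), which admits no continuous sub-action: the maximum $m(f,T)=\max_\mu\int f\,d\mu$ over the $T$-invariant Borel probability measures $\mu$ on $[0,1]$ is attained, and there is no continuous $u:[0,1]\to\mathbb R$ with $f(x)+u(x)-u(T(x))\le m(f,T)$ for all $x\in[0,1]$. -/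

import Mathlib

open Set Filter Topology MeasureTheory

/-- `V` is regularly varying at `0` with index `σ`: `V (t x) / V x → t ^ σ` as `x → 0⁺`,
for every `t > 0`. -/
def RegularlyVaryingAtZero (V : ℝ → ℝ) (σ : ℝ) : Prop :=
  ∀ t : ℝ, 0 < t → Tendsto (fun x : ℝ => V (t * x) / V x) (𝓝[>] 0) (𝓝 (t ^ σ))

/-- The function equal to `0` at `0`, to `h ^ α * (-log h) ^ (-β)` for `0 < h < h₀`, and
constant equal to `h₀ ^ α * (-log h₀) ^ (-β)` for `h ≥ h₀`. Only the values on `[0, ∞)` matter. -/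
noncomputable def logModulus (α β h₀ : ℝ) (h : ℝ) : ℝ :=
  if h ≤ 0 then 0
  else if h < h₀ then h ^ α * (-Real.log h) ^ (-β)
  else h₀ ^ α * (-Real.log h₀) ^ (-β)

/-- The functions on `[0,1]` having a multiple of `ω` as modulus of continuity. -/
def ModulusClass (ω : ℝ → ℝ) : Set (unitInterval → ℝ) :=
  {φ | ∃ C : ℝ, 0 < C ∧ ∀ x y : unitInterval, |φ x - φ y| ≤ C * ω (dist x y)}

/-- The set of all integrals `∫ f dμ`, for `μ` a `T`-invariant Borel probability measure
on `[0,1]`. -/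
def invariantAverages (T : unitInterval → unitInterval) (f : unitInterval → ℝ) : Set ℝ :=
  {a | ∃ μ : Measure unitInterval, IsProbabilityMeasure μ ∧ MeasurePreserving T μ μ ∧ ∫ x, f x ∂μ = a}

/-- The maximum ergodic average `m(f, T)`. -/
noncomputable def maxErgodicAverage (T : unitInterval → unitInterval) (f : unitInterval → ℝ) : ℝ :=
  sSup (invariantAverages T f)

/-- `u` is a sub-action for `f`: `f + u - u ∘ T ≤ m(f, T)` everywhere. -/
def IsSubAction (T : unitInterval → unitInterval) (f u : unitInterval → ℝ) : Prop :=
  ∀ x : unitInterval, f x + u x - u (T x) ≤ maxErgodicAverage T f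

/-! Near the fixed point `0`, a point at distance about `s` moves by about `s * V s` per step, so it
lingers at scale `s` for about `1 / V s` steps. A pulse of height about `V s` therefore accumulates
a total independent of `s`. Let `f` be the sum of such pulses over `s = r / 8 ^ n`, each followed
along the motion by a negative pulse.

The negative pulse pays for the descent of a tent of height one, so `f ≤ v ∘ T - v` with `v =
tentSum` (`wave_le_tent_sub`). Since `v` is bounded and measurable, although discontinuous at `0`,
every invariant average is at most `0`, and the Dirac mass at `0` attains it. A continuous
sub-action would have to grow by a fixed amount along orbit segments arbitrarily close to `0`, which
is absurd (`not_exists_continuous_of_waveSum`).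

For the modulus, the wave at scale `s` has size `V (4 * s)`, which is `O(V s)` by regular variation,
hence `O(s ^ σ)` by the lower limit, hence `O(ω s)`; concavity of `ω` transfers this to all
distances (`waveSum_sub_le`). -/

/-- The tent supported in `[1, 3]` with peak at `2`. -/
noncomputable def tent (z : ℝ) : ℝ := max 0 (1 - |z - 2|)

/-- A pulse supported in the rising part of `tent`. -/
noncomputable def risePulse (z : ℝ) : ℝ := max 0 (1 / 4 - |z - 5 / 4|)

/-- A pulse that is at least `1` on a neighbourhood of the falling part of `tent`. -/
noncomputable def fallPulse (z : ℝ) : ℝ := max 0 (7 / 2 - 4 * |z - 19 / 8|)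

/-- The coordinate `x / s`, reflected about `2` when `τ = -1`. -/
noncomputable def scaleCoord (τ s x : ℝ) : ℝ := 2 + τ * (x / s - 2)

/-- A positive pulse of height comparable to `V s`, compensated, in the direction of motion, by a
negative pulse. -/
noncomputable def wave (V : ℝ → ℝ) (τ s x : ℝ) : ℝ :=
  V s * risePulse (scaleCoord τ s x) - 4 * V (4 * s) * fallPulse (scaleCoord τ s x)

/-- The superposition of the waves at the scales `r / 8 ^ n`. -/
noncomputable def waveSum (V : ℝ → ℝ) (τ r x : ℝ) : ℝ := ∑' n : ℕ, wave V τ (r / 8 ^ n) x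

/-- The superposition of the tents at the scales `r / 8 ^ n`. -/
noncomputable def tentSum (τ r x : ℝ) : ℝ := ∑' n : ℕ, tent (scaleCoord τ (r / 8 ^ n) x)

/-! ### Estimates on the unscaled pulses -/

lemma tent_nonneg (z : ℝ) : 0 ≤ tent z := le_max_left _ _

lemma tent_le_one (z : ℝ) : tent z ≤ 1 :=
  max_le zero_le_one (by linarith [abs_nonneg (z - 2)])

lemma risePulse_nonneg (z : ℝ) : 0 ≤ risePulse z := le_max_left _ _

lemma fallPulse_nonneg (z : ℝ) : 0 ≤ fallPulse z := le_max_left _ _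

lemma risePulse_le (z : ℝ) : risePulse z ≤ 1 / 4 :=
  max_le (by norm_num) (by linarith [abs_nonneg (z - 5 / 4)])

lemma fallPulse_le (z : ℝ) : fallPulse z ≤ 7 / 2 :=
  max_le (by norm_num) (by linarith [abs_nonneg (z - 19 / 8)])

lemma risePulse_eq_zero {z : ℝ} (h : 1 / 4 ≤ |z - 5 / 4|) : risePulse z = 0 :=
  max_eq_left (by linarith)

lemma fallPulse_eq_zero {z : ℝ} (h : 7 / 8 ≤ |z - 19 / 8|) : fallPulse z = 0 :=
  max_eq_left (by linarith)

lemma tent_eq_zero {z : ℝ} (h : 1 ≤ |z - 2|) : tent z = 0 :=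
  max_eq_left (by linarith)

lemma risePulse_sub_le (z w : ℝ) : |risePulse z - risePulse w| ≤ |z - w| := by
  refine (abs_max_sub_max_le_max _ _ _ _).trans (max_le (by simp) ?_)
  rw [show 1 / 4 - |z - 5 / 4| - (1 / 4 - |w - 5 / 4|) = -(|z - 5 / 4| - |w - 5 / 4|) by ring,
    abs_neg]
  refine (abs_abs_sub_abs_le _ _).trans (le_of_eq ?_)
  ring_nf

lemma fallPulse_sub_le (z w : ℝ) : |fallPulse z - fallPulse w| ≤ 4 * |z - w| := by
  refine (abs_max_sub_max_le_max _ _ _ _).trans (max_le (by simp) ?_)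
  rw [show 7 / 2 - 4 * |z - 19 / 8| - (7 / 2 - 4 * |w - 19 / 8|)
    = -(4 * (|z - 19 / 8| - |w - 19 / 8|)) by ring, abs_neg, abs_mul, abs_of_pos four_pos]
  refine mul_le_mul_of_nonneg_left ((abs_abs_sub_abs_le _ _).trans (le_of_eq ?_)) four_pos.le
  ring_nf

/-- The pulses are dominated by the increment of the tent. -/
lemma pulse_le_tent_sub {A B z d : ℝ} (hd : 0 ≤ d) (hd4 : d ≤ 1 / 4) (hA : 0 ≤ A)
    (hAd : 1 ≤ z → z ≤ 3 / 2 → A ≤ d) (hdB : d ≤ B) :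
    A * risePulse z - B * fallPulse z ≤ tent (z + d) - tent z := by
  have hB : 0 ≤ B := hd.trans hdB
  have hBf : 0 ≤ B * fallPulse z := mul_nonneg hB (fallPulse_nonneg z)
  rcases lt_or_ge z 1 with h1 | h1
  · rw [risePulse_eq_zero (by rw [abs_of_nonpos (by linarith)]; linarith),
      tent_eq_zero (z := z) (by rw [abs_of_nonpos (by linarith)]; linarith)]
    linarith [tent_nonneg (z + d)]
  rcases le_or_gt z (3 / 2) with h2 | h2
  · have e1 : tent z = z - 1 := by
      rw [tent, abs_of_nonpos (by linarith), max_eq_right (by linarith)]; ring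
    have e2 : tent (z + d) = z + d - 1 := by
      rw [tent, abs_of_nonpos (by linarith), max_eq_right (by linarith)]; ring
    have := mul_le_mul_of_nonneg_left (risePulse_le z) hA
    linarith [hAd h1 h2]
  rw [risePulse_eq_zero (by rw [abs_of_nonneg (by linarith)]; linarith)]
  -- As `d ≤ 1 / 4`, the point has not passed the peak after the move.
  rcases le_or_gt z (7 / 4) with h3 | h3
  · have e1 : tent z = z - 1 := by
      rw [tent, abs_of_nonpos (by linarith), max_eq_right (by linarith)]; ring
    have e2 : tent (z + d) = z + d - 1 := by
      rw [tent, abs_of_nonpos (by linarith), max_eq_right (by linarith)]; ring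
    linarith
  rcases le_or_gt z 3 with h4 | h4
  · have hf : 1 ≤ fallPulse z := by
      refine le_max_of_le_right ?_
      have : |z - 19 / 8| ≤ 5 / 8 := abs_le.2 ⟨by linarith, by linarith⟩
      linarith
    have ht : tent z ≤ tent (z + d) + d := by
      refine max_le (by linarith [tent_nonneg (z + d)]) ?_
      have h5 : 1 - |z + d - 2| ≤ tent (z + d) := le_max_right _ _
      have h6 : |z + d - 2| ≤ |z - 2| + |d| := by
        rw [show z + d - 2 = (z - 2) + d by ring]; exact abs_add_le _ _
      rw [abs_of_nonneg hd] at h6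
      linarith
    have := mul_le_mul_of_nonneg_left hf hB
    linarith
  · rw [tent_eq_zero (z := z) (by rw [abs_of_nonneg (by linarith)]; linarith)]
    linarith [tent_nonneg (z + d)]

/-! ### Waves at a single scale -/

lemma scaleCoord_notMem {τ s x : ℝ} (hτ : τ = 1 ∨ τ = -1) (hs : 0 < s)
    (hx : x ∉ Ioo (s / 2) (4 * s)) : scaleCoord τ s x ∉ Ioo (1 / 2 : ℝ) (7 / 2) := by
  have hx' : x / s ≤ 1 / 2 ∨ 4 ≤ x / s := by
    rw [mem_Ioo, not_and_or, not_lt, not_lt] at hx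
    rcases hx with h | h
    · left; rw [div_le_iff₀ hs]; linarith
    · right; rw [le_div_iff₀ hs]; linarith
  rintro ⟨h1, h2⟩
  unfold scaleCoord at h1 h2
  rcases hτ with rfl | rfl <;> rcases hx' with h | h <;> linarith

lemma pulses_eq_zero {z : ℝ} (hz : z ∉ Ioo (1 / 2 : ℝ) (7 / 2)) :
    risePulse z = 0 ∧ fallPulse z = 0 ∧ tent z = 0 := by
  rw [mem_Ioo, not_and_or, not_lt, not_lt] at hz
  refine ⟨risePulse_eq_zero ?_, fallPulse_eq_zero ?_, tent_eq_zero ?_⟩ <;> rcases hz with h | h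
  all_goals first
    | (rw [abs_of_nonpos (by linarith)]; linarith)
    | (rw [abs_of_nonneg (by linarith)]; linarith)

lemma wave_eq_zero {V : ℝ → ℝ} {τ s x : ℝ} (hτ : τ = 1 ∨ τ = -1) (hs : 0 < s)
    (hx : x ∉ Ioo (s / 2) (4 * s)) : wave V τ s x = 0 := by
  obtain ⟨h1, h2, -⟩ := pulses_eq_zero (scaleCoord_notMem hτ hs hx)
  simp [wave, h1, h2]

lemma tent_scaleCoord_eq_zero {τ s x : ℝ} (hτ : τ = 1 ∨ τ = -1) (hs : 0 < s)
    (hx : x ∉ Ioo (s / 2) (4 * s)) : tent (scaleCoord τ s x) = 0 :=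
  (pulses_eq_zero (scaleCoord_notMem hτ hs hx)).2.2

/-- The increment of a tent along the dynamics dominates the wave at the same scale. -/
lemma wave_le_tent_sub {V : ℝ → ℝ} {τ s x y : ℝ} (hτ : τ = 1 ∨ τ = -1) (hs : 0 < s)
    (hmono : StrictMonoOn V (Ici 0)) (hpos : ∀ x, 0 < x → 0 < V x)
    (hsmall : x < 4 * s → V x ≤ 1 / 16)
    (hy : x < 4 * s → y = x * (1 + τ * V x)) :
    wave V τ s x ≤ tent (scaleCoord τ s y) - tent (scaleCoord τ s x) := by
  by_cases hx : x ∈ Ioo (s / 2) (4 * s)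
  · have hx0 : 0 < x := (half_pos hs).trans hx.1
    have hVx := hpos x hx0
    have hττ : τ * τ = 1 := by rcases hτ with rfl | rfl <;> norm_num
    -- The reflection makes the motion increase the coordinate for both signs of `τ`.
    have hcoord : scaleCoord τ s y = scaleCoord τ s x + x / s * V x := by
      rw [hy hx.2, scaleCoord, scaleCoord]
      linear_combination (x / s * V x) * hττ
    have hz4 : x / s ≤ 4 := by rw [div_le_iff₀ hs]; exact hx.2.le
    have hz0 : 0 < x / s := div_pos hx0 hs
    have hV4 : V x ≤ V (4 * s) :=
      hmono.monotoneOn hx0.le (show (0 : ℝ) ≤ 4 * s by positivity) hx.2.le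
    rw [hcoord, wave]
    refine pulse_le_tent_sub (by positivity) ?_ (hpos s hs).le ?_ ?_
    · calc x / s * V x ≤ 4 * (1 / 16) :=
            mul_le_mul hz4 (hsmall hx.2) hVx.le (by norm_num)
        _ = 1 / 4 := by norm_num
    · intro h1 h2
      -- `x / s` lies in `[1, 3/2]`, or in `[5/2, 3]` after reflection.
      have hz1 : 1 ≤ x / s := by
        unfold scaleCoord at h1 h2
        rcases hτ with rfl | rfl <;> linarith
      have hsx : s ≤ x := by rwa [le_div_iff₀ hs, one_mul] at hz1
      have := hmono.monotoneOn (mem_Ici.2 hs.le) (mem_Ici.2 hx0.le) hsx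
      nlinarith
    · exact mul_le_mul hz4 hV4 hVx.le (by norm_num)
  · rw [wave_eq_zero hτ hs hx, tent_scaleCoord_eq_zero hτ hs hx, sub_zero]
    exact tent_nonneg _

lemma abs_scaleCoord_sub {τ s : ℝ} (hτ : τ = 1 ∨ τ = -1) (hs : 0 < s) (x y : ℝ) :
    |scaleCoord τ s x - scaleCoord τ s y| = |x - y| / s := by
  have : scaleCoord τ s x - scaleCoord τ s y = τ * ((x - y) / s) := by
    unfold scaleCoord; ring
  rw [this, abs_mul, abs_div, abs_of_pos hs]
  rcases hτ with rfl | rfl <;> simp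

lemma abs_sub_le_of_mem_Icc {a b c : ℝ} (ha : 0 ≤ a) (ha' : a ≤ c) (hb : 0 ≤ b) (hb' : b ≤ c) :
    |a - b| ≤ c := abs_le.2 ⟨by linarith, by linarith⟩

/-- Combines the sup bound with the Lipschitz bound, in the shape that concavity of `ω` can absorb;
`20` rounds up `1 + 4 * 4`. -/
lemma wave_sub_le {V : ℝ → ℝ} {τ s : ℝ} (hτ : τ = 1 ∨ τ = -1) (hs : 0 < s)
    (hmono : StrictMonoOn V (Ici 0)) (hpos : ∀ x, 0 < x → 0 < V x) (x y : ℝ) :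
    |wave V τ s x - wave V τ s y| ≤ 20 * V (4 * s) * min 1 (|x - y| / s) := by
  have hV4 : V s ≤ V (4 * s) := hmono.monotoneOn (mem_Ici.2 hs.le)
    (show (0 : ℝ) ≤ 4 * s by positivity) (by linarith)
  have hV := hpos s hs
  rw [← abs_scaleCoord_sub hτ hs]
  unfold wave
  have hV4p : 0 < V (4 * s) := hV.trans_le hV4
  generalize scaleCoord τ s x = z
  generalize scaleCoord τ s y = w
  set m := min 1 |z - w| with hm
  have hm0 : 0 ≤ m := le_min zero_le_one (abs_nonneg _)
  have h1 : |risePulse z - risePulse w| ≤ m := by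
    refine le_min ?_ (risePulse_sub_le z w)
    have := abs_sub_le_of_mem_Icc (risePulse_nonneg z) (risePulse_le z) (risePulse_nonneg w)
      (risePulse_le w)
    linarith
  have h2 : |fallPulse z - fallPulse w| ≤ 4 * m := by
    rw [hm, mul_min_of_nonneg _ _ four_pos.le]
    refine le_min ?_ (fallPulse_sub_le z w)
    have := abs_sub_le_of_mem_Icc (fallPulse_nonneg z) (fallPulse_le z) (fallPulse_nonneg w)
      (fallPulse_le w)
    linarith
  calc _ = |V s * (risePulse z - risePulse w) - 4 * V (4 * s) * (fallPulse z - fallPulse w)| := by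
        ring_nf
    _ ≤ |V s * (risePulse z - risePulse w)| + |4 * V (4 * s) * (fallPulse z - fallPulse w)| :=
        abs_sub _ _
    _ = V s * |risePulse z - risePulse w| + 4 * V (4 * s) * |fallPulse z - fallPulse w| := by
        rw [abs_mul, abs_mul, abs_of_pos hV, abs_of_pos (by linarith : 0 < 4 * V (4 * s))]
    _ ≤ V (4 * s) * m + 4 * V (4 * s) * (4 * m) := by
        gcongr
    _ ≤ 20 * V (4 * s) * m := by nlinarith

lemma wave_ge {V : ℝ → ℝ} {τ s x : ℝ} (hV : 0 ≤ V s)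
    (hx : |scaleCoord τ s x - 5 / 4| ≤ 1 / 8) : V s / 8 ≤ wave V τ s x := by
  have hx' := abs_le.1 hx
  rw [wave, fallPulse_eq_zero (by rw [abs_of_nonpos (by linarith)]; linarith)]
  have : 1 / 8 ≤ risePulse (scaleCoord τ s x) := le_max_of_le_right (by linarith)
  nlinarith

/-! ### Superposition over all scales -/

/-- At most one scale is active at each point. -/
lemma exists_scale {r : ℝ} (hr : 0 < r) (x : ℝ) :
    ∃ n : ℕ, ∀ m : ℕ, m ≠ n → x ∉ Ioo (r / 8 ^ m / 2) (4 * (r / 8 ^ m)) := by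
  have key : ∀ m n : ℕ, m < n → x ∈ Ioo (r / 8 ^ m / 2) (4 * (r / 8 ^ m)) →
      x ∉ Ioo (r / 8 ^ n / 2) (4 * (r / 8 ^ n)) := by
    intro m n hmn hm hn
    -- The ratio `8 = 4 / (1 / 2)` is just enough to make consecutive windows disjoint.
    have h8 : (8 : ℝ) ^ (m + 1) ≤ 8 ^ n := pow_le_pow_right₀ (by norm_num) hmn
    have : r / 8 ^ n ≤ r / 8 ^ (m + 1) := div_le_div_of_nonneg_left hr.le (by positivity) h8
    have e : r / 8 ^ (m + 1) = r / 8 ^ m / 8 := by rw [pow_succ, div_div]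
    linarith [hm.1, hn.2]
  by_cases h : ∃ n : ℕ, x ∈ Ioo (r / 8 ^ n / 2) (4 * (r / 8 ^ n))
  · obtain ⟨n, hn⟩ := h
    refine ⟨n, fun m hmn hm => ?_⟩
    rcases lt_or_gt_of_ne hmn with h | h
    · exact key m n h hm hn
    · exact key n m h hn hm
  · exact ⟨0, fun m _ hm => h ⟨m, hm⟩⟩

lemma waveSum_eq_sum {V : ℝ → ℝ} {τ r x : ℝ} (hτ : τ = 1 ∨ τ = -1) (hr : 0 < r) {F : Finset ℕ}
    (hF : ∀ m ∉ F, x ∉ Ioo (r / 8 ^ m / 2) (4 * (r / 8 ^ m))) :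
    waveSum V τ r x = ∑ n ∈ F, wave V τ (r / 8 ^ n) x :=
  tsum_eq_sum fun m hm => wave_eq_zero hτ (by positivity) (hF m hm)

lemma tentSum_eq_sum {τ r x : ℝ} (hτ : τ = 1 ∨ τ = -1) (hr : 0 < r) {F : Finset ℕ}
    (hF : ∀ m ∉ F, x ∉ Ioo (r / 8 ^ m / 2) (4 * (r / 8 ^ m))) :
    tentSum τ r x = ∑ n ∈ F, tent (scaleCoord τ (r / 8 ^ n) x) :=
  tsum_eq_sum fun m hm => tent_scaleCoord_eq_zero hτ (by positivity) (hF m hm)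

/-- Two points activate at most two scales. -/
lemma exists_scale_pair {r : ℝ} (hr : 0 < r) (x y : ℝ) :
    ∃ F : Finset ℕ, F.card ≤ 2 ∧
      (∀ m ∉ F, x ∉ Ioo (r / 8 ^ m / 2) (4 * (r / 8 ^ m))) ∧
      (∀ m ∉ F, y ∉ Ioo (r / 8 ^ m / 2) (4 * (r / 8 ^ m))) := by
  obtain ⟨n, hn⟩ := exists_scale hr x
  obtain ⟨k, hk⟩ := exists_scale hr y
  refine ⟨{n, k}, Finset.card_le_two, fun m hm => hn m ?_, fun m hm => hk m ?_⟩ <;>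
  · rintro rfl
    simp at hm

lemma waveSum_zero {V : ℝ → ℝ} {τ r : ℝ} (hτ : τ = 1 ∨ τ = -1) (hr : 0 < r) :
    waveSum V τ r 0 = 0 := by
  rw [waveSum_eq_sum hτ hr (F := ∅), Finset.sum_empty]
  rintro m - ⟨h, -⟩
  have : 0 < r / 8 ^ m := by positivity
  linarith

lemma waveSum_eq_wave {V : ℝ → ℝ} {τ r x : ℝ} (hτ : τ = 1 ∨ τ = -1) (hr : 0 < r) (n : ℕ)
    (hx : x ∈ Ioo (r / 8 ^ n / 2) (4 * (r / 8 ^ n))) :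
    waveSum V τ r x = wave V τ (r / 8 ^ n) x := by
  obtain ⟨k, hk⟩ := exists_scale hr x
  have hnk : n = k := by
    by_contra h
    exact hk n h hx
  subst hnk
  rw [waveSum_eq_sum hτ hr (F := {n}) (fun m hm => hk m (by simpa using hm)), Finset.sum_singleton]

lemma tentSum_mem_Icc {τ r : ℝ} (hτ : τ = 1 ∨ τ = -1) (hr : 0 < r) (x : ℝ) :
    tentSum τ r x ∈ Icc (0 : ℝ) 1 := by
  obtain ⟨n, hn⟩ := exists_scale hr x
  rw [tentSum_eq_sum hτ hr (F := {n}) (fun m hm => hn m (by simpa using hm)), Finset.sum_singleton]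
  exact ⟨tent_nonneg _, tent_le_one _⟩

lemma measurable_tentSum {τ r : ℝ} (hτ : τ = 1 ∨ τ = -1) (hr : 0 < r) :
    Measurable (tentSum τ r) := by
  refine measurable_of_tendsto_metrizable
    (f := fun N x => ∑ n ∈ Finset.range N, tent (scaleCoord τ (r / 8 ^ n) x)) (fun N => ?_) ?_
  · refine Continuous.measurable ?_
    unfold tent scaleCoord
    fun_prop
  · rw [tendsto_pi_nhds]
    intro x
    obtain ⟨n, hn⟩ := exists_scale hr x
    refine (summable_of_ne_finset_zero (s := {n}) fun m hm => ?_).hasSum.tendsto_sum_nat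
    exact tent_scaleCoord_eq_zero hτ (by positivity) (hn m (by simpa using hm))

lemma scale_le {r : ℝ} (hr : 0 < r) (n : ℕ) : r / 8 ^ n ≤ r :=
  div_le_self hr.le (one_le_pow₀ (by norm_num))

lemma waveSum_le_tentSum_sub {V : ℝ → ℝ} {τ r x y : ℝ} (hτ : τ = 1 ∨ τ = -1) (hr : 0 < r)
    (hmono : StrictMonoOn V (Ici 0)) (hpos : ∀ x, 0 < x → 0 < V x)
    (hsmall : x < 4 * r → V x ≤ 1 / 16)
    (hy : x < 4 * r → y = x * (1 + τ * V x)) :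
    waveSum V τ r x ≤ tentSum τ r y - tentSum τ r x := by
  obtain ⟨F, -, hFx, hFy⟩ := exists_scale_pair hr x y
  rw [waveSum_eq_sum hτ hr hFx, tentSum_eq_sum hτ hr hFx, tentSum_eq_sum hτ hr hFy,
    ← Finset.sum_sub_distrib]
  refine Finset.sum_le_sum fun n _ => ?_
  have hn := scale_le hr n
  exact wave_le_tent_sub hτ (by positivity) hmono hpos (fun h => hsmall (by linarith))
    (fun h => hy (by linarith))

lemma waveSum_sub_le {V : ℝ → ℝ} {τ r K : ℝ} {ω : ℝ → ℝ} (hτ : τ = 1 ∨ τ = -1) (hr : 0 < r)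
    (hmono : StrictMonoOn V (Ici 0)) (hpos : ∀ x, 0 < x → 0 < V x) (hK : 0 ≤ K)
    (hVω : ∀ s, 0 < s → s ≤ r → V (4 * s) ≤ K * ω s)
    (hωmin : ∀ s h, 0 < s → s ≤ r → 0 ≤ h → ω s * min 1 (h / s) ≤ ω h) (x y : ℝ) :
    |waveSum V τ r x - waveSum V τ r y| ≤ 40 * K * ω |x - y| := by
  obtain ⟨F, hF, hFx, hFy⟩ := exists_scale_pair hr x y
  rw [waveSum_eq_sum hτ hr hFx, waveSum_eq_sum hτ hr hFy, ← Finset.sum_sub_distrib]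
  -- Nonnegativity of `ω` is not assumed; it comes from positivity of `V`.
  have hω0 : 0 ≤ K * ω |x - y| := by
    have h1 : 0 ≤ K * ω r := (hpos (4 * r) (by positivity)).le.trans (hVω r hr le_rfl)
    have h2 := mul_le_mul_of_nonneg_left (hωmin r |x - y| hr le_rfl (abs_nonneg _)) hK
    have h3 : 0 ≤ min 1 (|x - y| / r) := le_min zero_le_one (by positivity)
    nlinarith [mul_nonneg h1 h3]
  have hterm : ∀ n ∈ F, |wave V τ (r / 8 ^ n) x - wave V τ (r / 8 ^ n) y|
      ≤ 20 * (K * ω |x - y|) := by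
    intro n _
    have hs : 0 < r / 8 ^ n := by positivity
    have hsr := scale_le hr n
    generalize r / 8 ^ n = s at hs hsr
    have hm : 0 ≤ min 1 (|x - y| / s) := le_min zero_le_one (by positivity)
    refine (wave_sub_le hτ hs hmono hpos x y).trans ?_
    have h1 := mul_le_mul_of_nonneg_right (hVω s hs hsr) hm
    have h2 := mul_le_mul_of_nonneg_left (hωmin s |x - y| hs hsr (abs_nonneg _)) hK
    nlinarith
  calc _ ≤ ∑ n ∈ F, |wave V τ (r / 8 ^ n) x - wave V τ (r / 8 ^ n) y| :=
        Finset.abs_sum_le_sum_abs _ _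
    _ ≤ F.card • (20 * (K * ω |x - y|)) := Finset.sum_le_card_nsmul _ _ _ hterm
    _ ≤ 40 * K * ω |x - y| := by
        rw [nsmul_eq_mul]
        have : (F.card : ℝ) ≤ 2 := by exact_mod_cast hF
        nlinarith

/-! ### The maximum ergodic average -/

/-- A coboundary bound forces `m(f, T) = 0` when `f` vanishes at a fixed point. -/
lemma isGreatest_invariantAverages_zero {T : unitInterval → unitInterval} (hT : Measurable T)
    {f v : unitInterval → ℝ} {p : unitInterval} (hp : T p = p) (hfp : f p = 0)
    (hv : Measurable v) (hvb : ∀ x, v x ∈ Icc (0 : ℝ) 1) (hfv : ∀ x, f x ≤ v (T x) - v x) :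
    IsGreatest (invariantAverages T f) 0 := by
  constructor
  · refine ⟨Measure.dirac p, inferInstance, ⟨hT, ?_⟩, ?_⟩
    · rw [Measure.map_dirac' hT, hp]
    · rw [integral_dirac, hfp]
  · rintro a ⟨μ, hμ, hTμ, rfl⟩
    have hvi : Integrable v μ := by
      refine Integrable.of_bound hv.aestronglyMeasurable 1 (ae_of_all _ fun x => ?_)
      rw [Real.norm_of_nonneg (hvb x).1]
      exact (hvb x).2
    have hvT : Integrable (fun x => v (T x)) μ := hTμ.integrable_comp_of_integrable hvi
    -- Without integrability the integral is `0` by convention, so the bound persists.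
    by_cases hf : Integrable f μ
    · have e : ∫ x, v (T x) ∂μ = ∫ x, v x ∂μ := by
        conv_rhs => rw [← hTμ.map_eq]
        exact (integral_map hT.aemeasurable hv.aestronglyMeasurable).symm
      calc ∫ x, f x ∂μ ≤ ∫ x, (v (T x) - v x) ∂μ := integral_mono hf (hvT.sub hvi) hfv
        _ = 0 := by rw [integral_sub hvT hvi, e, sub_self]
    · rw [integral_undef hf]

/-! ### Obstruction to continuity at the fixed point -/

lemma add_sum_le_iterate {X : Type*} {T : X → X} {f u : X → ℝ} {c : ℝ} {x : X} {N : ℕ}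
    (hu : ∀ x, f x + u x ≤ u (T x)) (hf : ∀ k < N, c ≤ f (T^[k] x)) :
    N * c + u x ≤ u (T^[N] x) := by
  induction N with
  | zero => simp
  | succ N ih =>
    have h1 := ih fun k hk => hf k (hk.trans N.lt_succ_self)
    have h2 := hf N N.lt_succ_self
    have h3 := hu (T^[N] x)
    rw [Function.iterate_succ_apply']
    push_cast
    linarith

/-- Points move slowly: the orbit stays close to its starting point for a long time. -/
lemma iterate_mem {T : unitInterval → unitInterval} {V : ℝ → ℝ} {τ s c : ℝ}
    (hτ : τ = 1 ∨ τ = -1) (hs : 0 < s) (hmono : StrictMonoOn V (Ici 0))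
    (hpos : ∀ x, 0 < x → 0 < V x)
    (hT : ∀ x : unitInterval, (x : ℝ) < 4 * s → (T x : ℝ) = x * (1 + τ * V x))
    (hc1 : 1 ≤ c) (hc3 : c ≤ 3) {x : unitInterval} (hx : (x : ℝ) = c * s) {k : ℕ}
    (hk : k * (4 * V (4 * s)) ≤ 1 / 8) :
    |(T^[k] x : ℝ) - c * s| ≤ k * (4 * V (4 * s)) * s := by
  have hV4 := hpos (4 * s) (by positivity)
  induction k with
  | zero => simp [hx]
  | succ k ih =>
    push_cast at hk ⊢
    have hk' : k * (4 * V (4 * s)) ≤ 1 / 8 := by linarith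
    have h1 := ih hk'
    rw [Function.iterate_succ_apply']
    set y := T^[k] x
    -- Staying within `s / 8` of `c * s` keeps the iterate below `4 * s`, where the formula for `T`
    -- and `V y ≤ V (4 * s)` apply.
    have h1' : |(y : ℝ) - c * s| ≤ 1 / 8 * s := h1.trans (by gcongr)
    have h2 := abs_le.1 h1'
    have hcs : c * s ≤ 3 * s := by gcongr
    have hcs1 : 1 * s ≤ c * s := by gcongr
    have hy4 : (y : ℝ) < 4 * s := by linarith
    have hy0 : 0 < (y : ℝ) := by linarith
    have hVy := hpos y hy0
    have hstep : |(T y : ℝ) - y| ≤ 4 * s * V (4 * s) := by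
      rw [hT y hy4, show (y : ℝ) * (1 + τ * V y) - y = τ * (y * V y) by ring, abs_mul,
        abs_of_pos (mul_pos hy0 hVy)]
      have : |τ| = 1 := by rcases hτ with rfl | rfl <;> simp
      rw [this, one_mul]
      exact mul_le_mul hy4.le (hmono.monotoneOn hy0.le (show (0 : ℝ) ≤ 4 * s by positivity) hy4.le)
        hVy.le (by positivity)
    have := abs_sub_le (T y : ℝ) y (c * s)
    linarith

/-- An orbit started at the centre of a positive pulse gains at least `V s / 8` for `N ≥ 1 / (64 * V
(4 * s))` steps. By doubling the total is at least `1 / (512 * D)`, at every scale, whereas `u`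
varies less than that near `0`. -/
lemma not_exists_continuous_of_waveSum {T : unitInterval → unitInterval} {V : ℝ → ℝ} {τ r D : ℝ}
    (hτ : τ = 1 ∨ τ = -1) (hr : 0 < r) (hr1 : 4 * r ≤ 1)
    (hmono : StrictMonoOn V (Ici 0)) (hpos : ∀ x, 0 < x → 0 < V x)
    (hT : ∀ x : unitInterval, (x : ℝ) < 4 * r → (T x : ℝ) = x * (1 + τ * V x))
    (hD : ∀ s, 0 < s → s ≤ r → V (4 * s) ≤ D * V s)
    (hsmall : ∀ s, 0 < s → s ≤ r → V (4 * s) ≤ 1 / 64) {u : unitInterval → ℝ}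
    (hu : Continuous u) (hfu : ∀ x : unitInterval, waveSum V τ r x + u x ≤ u (T x)) : False := by
  have hD0 : 0 < D := by
    by_contra h
    have h1 := hD r hr le_rfl
    have h2 := hpos r hr
    have h3 := hpos (4 * r) (by positivity)
    nlinarith
  have hε : 0 < 1 / (512 * D) := by positivity
  obtain ⟨η, hη, hηu⟩ := Metric.continuousAt_iff.1 (hu.continuousAt (x := 0)) _ (half_pos hε)
  have hlim : Tendsto (fun n : ℕ => r / 8 ^ n) atTop (𝓝 0) :=
    tendsto_const_nhds.div_atTop (tendsto_pow_atTop_atTop_of_one_lt (by norm_num))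
  obtain ⟨n, hn⟩ := (hlim.eventually (gt_mem_nhds (show 0 < η / 4 by positivity))).exists
  have hs : 0 < r / 8 ^ n := by positivity
  have hsr := scale_le hr n
  have hwave := fun x => waveSum_eq_wave (V := V) (x := x) hτ hr n
  generalize r / 8 ^ n = s at hn hs hsr hwave
  have hVs := hpos s hs
  have hV4 := hpos (4 * s) (by positivity)
  -- `c * s` is the centre of the positive pulse: `c = 5/4`, or `11/4` when reflected.
  obtain ⟨c, hc, hc1, hc3⟩ : ∃ c : ℝ, scaleCoord τ s (c * s) = 5 / 4 ∧ 5 / 4 ≤ c ∧ c ≤ 11 / 4 := by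
    refine ⟨2 - τ * (3 / 4), ?_, ?_, ?_⟩
    · rw [scaleCoord, mul_div_cancel_right₀ _ hs.ne']
      rcases hτ with rfl | rfl <;> norm_num
    all_goals rcases hτ with rfl | rfl <;> norm_num
  have hcs : c * s ≤ 11 / 4 * s := by gcongr
  have hcs1 : 5 / 4 * s ≤ c * s := by gcongr
  set x : unitInterval := ⟨c * s, by positivity, by linarith⟩ with hx
  have hxc : (x : ℝ) = c * s := rfl
  -- The largest `N` with `N * (4 * V (4 * s)) ≤ 1 / 8`, so that the orbit stays in the inner half
  -- of the pulse.
  set N := ⌊1 / (32 * V (4 * s))⌋₊ with hN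
  have hNle : (N : ℝ) ≤ 1 / (32 * V (4 * s)) := Nat.floor_le (by positivity)
  have hN1 : 1 / (32 * V (4 * s)) < N + 1 := Nat.lt_floor_add_one _
  have hbd : ∀ k : ℕ, k ≤ N → |(T^[k] x : ℝ) - c * s| ≤ 1 / 8 * s := by
    intro k hk
    have hk' : (k : ℝ) * (4 * V (4 * s)) ≤ 1 / 8 := by
      have : (k : ℝ) ≤ 1 / (32 * V (4 * s)) := le_trans (by exact_mod_cast hk) hNle
      rw [le_div_iff₀ (by positivity)] at this
      linarith
    refine (iterate_mem hτ hs hmono hpos (fun y hy => hT y (by linarith)) (by linarith)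
      (by linarith) hxc hk').trans (by gcongr)
  have hclose : ∀ k : ℕ, k ≤ N → |u (T^[k] x) - u 0| < 1 / (512 * D) / 2 := by
    intro k hk
    refine hηu ?_
    have h1 := abs_le.1 (hbd k hk)
    rw [Subtype.dist_eq, Real.dist_eq, Set.Icc.coe_zero, sub_zero, abs_of_pos (by linarith)]
    linarith
  have hsum : N * (V s / 8) + u x ≤ u (T^[N] x) := by
    refine add_sum_le_iterate (f := fun y : unitInterval => waveSum V τ r y) hfu fun k hk => ?_
    have h1 := hbd k hk.le
    have h2 := abs_le.1 h1
    rw [hwave _ ⟨by linarith, by linarith⟩]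
    refine wave_ge hVs.le ?_
    rw [← hc, abs_scaleCoord_sub hτ hs, div_le_iff₀ hs]
    exact h1
  have h0 := abs_lt.1 (hclose 0 (Nat.zero_le _))
  have h1 := abs_lt.1 (hclose N le_rfl)
  rw [Function.iterate_zero_apply] at h0
  -- Rounding down costs at most half, since `V (4 * s) ≤ 1 / 64`.
  have hNV : 1 / (64 * V (4 * s)) ≤ N := by
    have e : 1 / (32 * V (4 * s)) = 1 / (64 * V (4 * s)) + 1 / (64 * V (4 * s)) := by
      field_simp; norm_num
    have : 1 ≤ 1 / (64 * V (4 * s)) := by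
      rw [le_div_iff₀ (by positivity)]
      linarith [hsmall s hs hsr]
    linarith
  have hlow : 1 / (512 * D) ≤ N * (V s / 8) := by
    calc 1 / (512 * D) ≤ 1 / (64 * V (4 * s)) * (V s / 8) := by
          rw [div_mul_div_comm, div_le_div_iff₀ (by positivity) (by positivity)]
          linarith [hD s hs hsr]
      _ ≤ N * (V s / 8) := by gcongr
  linarith

/-! ### The modulus and its comparison with `V` -/

lemma logModulus_const {α β h₀ : ℝ} (hh₀ : 0 < h₀) {h : ℝ} (hh : h₀ ≤ h) :
    logModulus α β h₀ h = h₀ ^ α * (-Real.log h₀) ^ (-β) := by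
  rw [logModulus, if_neg (by linarith), if_neg (by linarith)]

/-- Slopes of a concave function decrease, and they are eventually `0` here, so none is negative. -/
lemma logModulus_le_of_le {α β h₀ : ℝ} (hh₀ : 0 < h₀)
    (hω : ConcaveOn ℝ (Ici 0) (logModulus α β h₀)) {s h : ℝ} (hs : 0 ≤ s) (hsh : s ≤ h) :
    logModulus α β h₀ s ≤ logModulus α β h₀ h := by
  rcases hsh.eq_or_lt with rfl | hlt
  · exact le_rfl
  set p := max h h₀ + 1 with hp
  have hph : h < p := by linarith [le_max_left h h₀]
  have hph₀ : h₀ ≤ p := by linarith [le_max_right h h₀]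
  have h1 := hω.slope_anti_adjacent (mem_Ici.2 hs) (show (0 : ℝ) ≤ p by linarith) hlt hph
  have h2 := hω.slope_anti_adjacent (show (0 : ℝ) ≤ h by linarith)
    (show (0 : ℝ) ≤ p + 1 by linarith) hph (lt_add_one p)
  rw [logModulus_const hh₀ (show h₀ ≤ p + 1 by linarith), logModulus_const hh₀ hph₀, sub_self,
    zero_div, ← logModulus_const hh₀ hph₀] at h2
  have h3 := h2.trans h1
  rw [le_div_iff₀ (by linarith)] at h3
  linarith

/-- Monotonicity handles `s ≤ h`; otherwise `h` lies between `0` and `s`, and concavity with value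
`0` at `0` applies. -/
lemma logModulus_mul_min_le {α β h₀ : ℝ} (hh₀ : 0 < h₀)
    (hω : ConcaveOn ℝ (Ici 0) (logModulus α β h₀)) {s h : ℝ} (hs : 0 < s) (hh : 0 ≤ h) :
    logModulus α β h₀ s * min 1 (h / s) ≤ logModulus α β h₀ h := by
  rcases le_total s h with hsh | hsh
  · rw [min_eq_left (by rwa [le_div_iff₀ hs, one_mul]), mul_one]
    exact logModulus_le_of_le hh₀ hω hs.le hsh
  · have hq : h / s ≤ 1 := by rwa [div_le_iff₀ hs, one_mul]
    have h0 : 0 ≤ h / s := by positivity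
    rw [min_eq_right hq]
    have := hω.2 (mem_Ici.2 le_rfl) (mem_Ici.2 hs.le) (sub_nonneg.2 hq) h0 (sub_add_cancel _ _)
    have hz : logModulus α β h₀ 0 = 0 := by simp [logModulus]
    rw [smul_eq_mul, smul_eq_mul, smul_eq_mul, smul_eq_mul, mul_zero, hz, mul_zero, zero_add,
      zero_add, div_mul_cancel₀ _ hs.ne'] at this
    linarith

/-- If `α < σ`, the factor `x ^ (α - σ)` beats any power of the logarithm. -/
lemma eventually_rpow_le_logModulus {σ α β h₀ : ℝ} (hh₀ : 0 < h₀) (hh₀1 : h₀ < 1)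
    (hαβ : (α = σ ∧ β = 0) ∨ α < σ) :
    ∀ᶠ x in 𝓝[>] (0 : ℝ), x ^ σ ≤ logModulus α β h₀ x := by
  have hmem : ∀ᶠ x in 𝓝[>] (0 : ℝ), x ∈ Ioo 0 h₀ := Ioo_mem_nhdsGT hh₀
  rcases hαβ with ⟨rfl, rfl⟩ | hlt
  · filter_upwards [hmem] with x hx
    simp [logModulus, hx.1.not_ge, hx.2]
  · have ho := (isLittleO_abs_log_rpow_rpow_nhdsGT_zero β (show α - σ < 0 by linarith)).bound
      (c := 1) one_pos
    filter_upwards [hmem, ho] with x hx hb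
    have hl : 0 < -Real.log x := neg_pos.2 (Real.log_neg hx.1 (hx.2.trans hh₀1))
    rw [abs_of_neg (neg_pos.1 hl), Real.norm_of_nonneg (by positivity),
      Real.norm_of_nonneg (Real.rpow_nonneg hx.1.le _), one_mul] at hb
    rw [logModulus, if_neg hx.1.not_ge, if_pos hx.2, Real.rpow_neg hl.le, ← div_eq_mul_inv,
      le_div_iff₀ (by positivity)]
    calc x ^ σ * (-Real.log x) ^ β ≤ x ^ σ * x ^ (α - σ) :=
          mul_le_mul_of_nonneg_left hb (Real.rpow_nonneg hx.1.le _)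
      _ = x ^ α := by rw [← Real.rpow_add hx.1]; ring_nf

lemma exists_eventually_le_rpow {V : ℝ → ℝ} {σ : ℝ} (hpos : ∀ x, 0 < x → 0 < V x)
    (hlim : 0 < Filter.liminf (fun x : ℝ => ((x ^ σ / V x : ℝ) : EReal)) (𝓝[>] 0)) :
    ∃ C : ℝ, 0 < C ∧ ∀ᶠ x in 𝓝[>] (0 : ℝ), V x ≤ C * x ^ σ := by
  obtain ⟨c, hc0, hc⟩ := EReal.lt_iff_exists_real_btwn.1 hlim
  have hc0' : 0 < c := by exact_mod_cast hc0
  refine ⟨c⁻¹, inv_pos.2 hc0', ?_⟩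
  filter_upwards [eventually_lt_of_lt_liminf hc, self_mem_nhdsWithin] with x hx hx0
  have hx' : c < x ^ σ / V x := by exact_mod_cast hx
  rw [lt_div_iff₀ (hpos x hx0)] at hx'
  rw [inv_mul_eq_div, le_div_iff₀ hc0']
  linarith

/-! ### Choice of constants and conclusion -/

theorem corollary1
    (σ : ℝ) (hσ : 0 < σ)
    (V : ℝ → ℝ)
    (hV_cont : ContinuousOn V (Set.Ici 0))
    (hV_mono : StrictMonoOn V (Set.Ici 0))
    (hV_range : ∀ x : ℝ, 0 < x → V x ∈ Set.Ioo (0 : ℝ) 1)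
    (hV_reg : RegularlyVaryingAtZero V σ)
    -- the lower limit is taken in the extended reals, so the value `+∞` is allowed
    (hV_liminf : 0 < Filter.liminf (fun x : ℝ => ((x ^ σ / V x : ℝ) : EReal)) (𝓝[>] 0))
    (T : unitInterval → unitInterval) (hT_meas : Measurable T)
    (δ : ℝ) (hδ : 0 < δ)
    (hT_inj : Set.InjOn T {x : unitInterval | (x : ℝ) < δ})
    (hT_form :
      (∀ x : unitInterval, (x : ℝ) < δ → (T x : ℝ) = (x : ℝ) * (1 + V x)) ∨
      (∀ x : unitInterval, (x : ℝ) < δ → (T x : ℝ) = (x : ℝ) * (1 - V x)))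
    (α β : ℝ)
    (hαβ : (α = σ ∧ β = 0) ∨ (0 ≤ α ∧ α < min σ 1 ∧ 0 ≤ β ∧ 0 < α + β))
    (h₀ : ℝ) (hh₀_pos : 0 < h₀) (hh₀_lt : h₀ < 1)
    (hω : ConcaveOn ℝ (Set.Ici 0) (logModulus α β h₀)) :
    ∃ f : unitInterval → ℝ, f ∈ ModulusClass (logModulus α β h₀) ∧
      IsGreatest (invariantAverages T f) (maxErgodicAverage T f) ∧
      ¬ ∃ u : unitInterval → ℝ, Continuous u ∧ IsSubAction T f u := by
  have hpos : ∀ x, 0 < x → 0 < V x := fun x hx => (hV_range x hx).1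
  obtain ⟨τ, hτ, hTτ⟩ : ∃ τ : ℝ, (τ = 1 ∨ τ = -1) ∧
      ∀ x : unitInterval, (x : ℝ) < δ → (T x : ℝ) = x * (1 + τ * V x) := by
    rcases hT_form with h | h
    · exact ⟨1, Or.inl rfl, fun x hx => by rw [h x hx, one_mul]⟩
    · exact ⟨-1, Or.inr rfl, fun x hx => by rw [h x hx]; ring⟩
  obtain ⟨C, hC, hVC⟩ := exists_eventually_le_rpow hpos hV_liminf
  have hωσ : ∀ᶠ x in 𝓝[>] (0 : ℝ), x ^ σ ≤ logModulus α β h₀ x :=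
    eventually_rpow_le_logModulus hh₀_pos hh₀_lt
      (hαβ.imp_right fun h => h.2.1.trans_le (min_le_left _ _))
  -- Any number above `4 ^ σ`, the limit of `V (4 * x) / V x`, would do.
  set D : ℝ := 4 ^ σ + 1 with hD
  have hD0 : 0 < D := by positivity
  have hdouble : ∀ᶠ x in 𝓝[>] (0 : ℝ), V (4 * x) ≤ D * V x := by
    filter_upwards [(hV_reg 4 four_pos).eventually (gt_mem_nhds (lt_add_one _)),
      self_mem_nhdsWithin] with x hx hx0
    exact ((div_lt_iff₀ (hpos x hx0)).1 hx).le
  have hsmall : ∀ᶠ x in 𝓝[>] (0 : ℝ), D * (C * x ^ σ) ≤ 1 / 64 := by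
    have h1 : Tendsto (fun x : ℝ => D * (C * x ^ σ)) (𝓝[>] 0) (𝓝 (D * (C * 0 ^ σ))) :=
      (((Real.continuous_rpow_const hσ.le).tendsto 0).const_mul C |>.const_mul D).mono_left
        nhdsWithin_le_nhds
    rw [Real.zero_rpow hσ.ne', mul_zero, mul_zero] at h1
    exact (h1.eventually (gt_mem_nhds (show (0 : ℝ) < 1 / 64 by norm_num))).mono fun _ h => h.le
  obtain ⟨ρ, hρ, hall⟩ :=
    mem_nhdsGT_iff_exists_Ioo_subset.1 (hVC.and (hωσ.and (hdouble.and hsmall)))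
  have hρ0 : (0 : ℝ) < ρ := hρ
  -- All asymptotic bounds hold up to `r`, and `4 * r` stays within both the domain of the formula
  -- for `T` and `[0, 1]`.
  set r := min (ρ / 2) (min (δ / 4) (1 / 4)) with hr_def
  have hr : 0 < r := by positivity
  have hrρ : r < ρ := (min_le_left _ _).trans_lt (half_lt_self hρ0)
  have hrδ : 4 * r ≤ δ := by
    have : r ≤ δ / 4 := (min_le_right _ _).trans (min_le_left _ _)
    linarith
  have hr1 : 4 * r ≤ 1 := by
    have : r ≤ 1 / 4 := (min_le_right _ _).trans (min_le_right _ _)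
    linarith
  have hscale : ∀ s, 0 < s → s ≤ r → V s ≤ C * s ^ σ ∧ s ^ σ ≤ logModulus α β h₀ s ∧
      V (4 * s) ≤ D * V s ∧ D * (C * s ^ σ) ≤ 1 / 64 :=
    fun s hs hsr => hall ⟨hs, hsr.trans_lt hrρ⟩
  have hV64 : ∀ s, 0 < s → s ≤ r → V (4 * s) ≤ 1 / 64 := by
    intro s hs hsr
    obtain ⟨h1, -, h3, h4⟩ := hscale s hs hsr
    exact h3.trans ((mul_le_mul_of_nonneg_left h1 hD0.le).trans h4)
  have hT0 : T 0 = 0 := Subtype.ext (by rw [hTτ 0 hδ]; simp)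
  have hgreat : IsGreatest (invariantAverages T fun x => waveSum V τ r x) 0 := by
    refine isGreatest_invariantAverages_zero hT_meas (v := fun x => tentSum τ r x) hT0
      (waveSum_zero hτ hr) ((measurable_tentSum hτ hr).comp measurable_subtype_coe)
      (fun x => tentSum_mem_Icc hτ hr x) fun x => ?_
    refine waveSum_le_tentSum_sub hτ hr hV_mono hpos (fun hx => ?_) fun hx => hTτ x (by linarith)
    have := hV_mono.monotoneOn (mem_Ici.2 x.2.1) (show (0 : ℝ) ≤ 4 * r by positivity) hx.le
    linarith [hV64 r hr le_rfl]
  have hmax : maxErgodicAverage T (fun x => waveSum V τ r x) = 0 := hgreat.csSup_eq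
  refine ⟨fun x => waveSum V τ r x, ⟨40 * (D * C), by positivity, fun x y => ?_⟩,
    hmax.symm ▸ hgreat, ?_⟩
  · rw [Subtype.dist_eq, Real.dist_eq]
    refine waveSum_sub_le hτ hr hV_mono hpos (by positivity) (fun s hs hsr => ?_)
      (fun s h hs _ hh => logModulus_mul_min_le hh₀_pos hω hs hh) x y
    obtain ⟨h1, h2, h3, -⟩ := hscale s hs hsr
    calc V (4 * s) ≤ D * V s := h3
      _ ≤ D * (C * logModulus α β h₀ s) := by gcongr; exact h1.trans (by gcongr)
      _ = D * C * logModulus α β h₀ s := by ring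
  · rintro ⟨u, hu, hsub⟩
    refine not_exists_continuous_of_waveSum hτ hr hr1 hV_mono hpos
      (fun x hx => hTτ x (by linarith)) (fun s hs hsr => (hscale s hs hsr).2.2.1) hV64 hu
      fun x => ?_
    have := hsub x
    rw [hmax] at this
    linarith
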